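/- Let $\mathcal X$ and $\mathcal Y$ be real locally convex Hausdorff topological vector spaces. $\Gamma_0(\mathcal X)$ denotes the set of proper lower semicontinuous convex functions from $\mathcal X$ to $]-\infty,+\infty]$. For a set $C$, $\iota_C$ is its indicator function ($0$ on $C$, $+\infty$ elsewhere) and $\overline{\mathrm{conv}}\,C$ is its closed convex hull. For a proper convex function $f$, $\mathrm{dom} f=\{x : f(x)<+\infty\}$ and its recession function is $(\mathrm{rec}\,f)(x)=\sup_{y\in\mathrm{dom} f}\big(f(x+y)-f(y)\big)$. Given $\varphi\colon\mathcal X\to[-\infty,+\infty]$ and $s\colon\mathcal Y\to[-\infty,+\infty]$, the preperspective $\varphi\ltimes s\colon\mathcal X\times\mathcal Y\to[-\infty,+\infty]$ is $$(\varphi\ltimes s)(x,y)=\begin{cases}s(y)\,\varphi\big(x/s(y)\big),&\text{if }0<s(y)<+\infty;\\+\infty,&\text{otherwise},\end{cases}$$ and the perspective $P$ of $\varphi$ with respect to $s$ is the largest lower semicontinuous convex function from $\mathcal X\times\mathcal Y$ to $[-\infty,+\infty]$ that minorizes $\varphi\ltimes s$. **Corollary.** Let $\varphi\in\Gamma_0(\mathcal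 X)$, let $s\colon\mathcal Y\to[-\infty,+\infty]$, and suppose that $S=\{y\in\mathcal Y : 0<s(y)<+\infty\}\neq\varnothing$. Then the following hold for all $x\in\mathcal X$ and $y\in\mathcal Y$. (i) If $\varphi\geq\mathrm{rec}\,\varphi\neq\varphi$ and $s\in\Gamma_0(\mathcal Y)$, then $$P(x,y)=\begin{cases}s(y)\,\varphi\big(x/s(y)\big),&\text{if }0<s(y)<+\infty;\\(\mathrm{rec}\,\varphi)(x),&\text{if }y\in\overline{\mathrm{conv}}\,S\text{ and }s(y)\leq 0;\\+\infty,&\text{otherwise}.\end{cases}$$ (ii) If $\varphi=\mathrm{rec}\,\varphi$, then $P(x,y)=\varphi(x)+\iota_{\overline{\mathrm{conv}}\,S}(y)$. (iii) If $\varphi\neq\mathrm{rec}\,\varphi$, $\varphi(0)\leq 0$, and $-s\in\Gamma_0(\mathcal Y)$, then $$P(x,y)=\begin{cases}s(y)\,\varphi\big(x/s(y)\big),&\text{if }0<s(y)<+\infty;\\(\mathrm{rec}\,\varphi)(x),&\text{if }s(y)=0;\\+\infty,&\text{otherwise}.\end{cases}$$ Furthermore, in each of the cases (i), (ii), (iii),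 $P\in\Gamma_0(\mathcal X\oplus\mathcal Y)$, where $\mathcal X\oplus\mathcal Y$ is $\mathcal X\times\mathcal Y$ with the product topology. -/

import Mathlib

open scoped Classical

namespace Perspective

section General

variable {E : Type*}

/-- The domain of an extended real-valued function. -/
def effDom (f : E → EReal) : Set E := {x | f x < ⊤}

/-- The epigraph of an extended real-valued function, a subset of `E × ℝ`. -/
def epi (f : E → EReal) : Set (E × ℝ) := {p | f p.1 ≤ (p.2 : EReal)}

/-- `f` is proper: it never takes the value `-∞` and it is not identically `+∞`. -/
def IsProper (f : E → EReal) : Prop := (∀ x, f x ≠ ⊥) ∧ ∃ x, f x ≠ ⊤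

/-- The indicator function of a set: `0` on the set and `+∞` outside of it. -/
noncomputable def indicatorFun (C : Set E) (x : E) : EReal := if x ∈ C then 0 else ⊤

/-- An extended real-valued function is convex if its epigraph is convex. -/
def IsConvexFun [AddCommGroup E] [Module ℝ E] (f : E → EReal) : Prop := Convex ℝ (epi f)

/-- The recession function `x ↦ sup_{y ∈ dom f} (f (x + y) - f y)` of a proper convex function. -/
noncomputable def recFun [AddCommGroup E] (f : E → EReal) (x : E) : EReal :=
  ⨆ y ∈ effDom f, (f (x + y) - f y)

/-- `f ∈ Γ₀(E)`: `f` is proper, lower semicontinuous and convex. -/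
structure MemGammaZero [AddCommGroup E] [Module ℝ E] [TopologicalSpace E] (f : E → EReal) :
    Prop where
  proper : IsProper f
  lsc : LowerSemicontinuous f
  convex : IsConvexFun f

end General

section Perspective

variable {X Y : Type*} [AddCommGroup X] [Module ℝ X]

/-- The preperspective of `φ` with respect to the scaling function `s`. -/
noncomputable def preperspective (φ : X → EReal) (s : Y → EReal) (p : X × Y) : EReal :=
  if 0 < s p.2 ∧ s p.2 < ⊤ then s p.2 * φ ((s p.2).toReal⁻¹ • p.1) else ⊤

variable [TopologicalSpace X] [AddCommGroup Y] [Module ℝ Y] [TopologicalSpace Y]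

/-- The perspective of `φ` with respect to `s`: the largest lower semicontinuous convex function
minorizing the preperspective, obtained as the pointwise supremum of all such functions
(see `perspective_isGreatest`). -/
noncomputable def perspective (φ : X → EReal) (s : Y → EReal) : X × Y → EReal :=
  sSup {g | LowerSemicontinuous g ∧ IsConvexFun g ∧ g ≤ preperspective φ s}

theorem perspective_isGreatest (φ : X → EReal) (s : Y → EReal) :
    IsGreatest {g : X × Y → EReal | LowerSemicontinuous g ∧ IsConvexFun g ∧
      g ≤ preperspective φ s} (perspective φ s) := by
  refine ⟨⟨?_, ?_, ?_⟩, fun g hg => le_sSup hg⟩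
  · have h : perspective φ s = fun p => ⨆ g : {g : X × Y → EReal | LowerSemicontinuous g ∧
        IsConvexFun g ∧ g ≤ preperspective φ s}, g.1 p := by
      funext p
      exact sSup_apply
    rw [h]
    exact lowerSemicontinuous_iSup fun g => g.2.1
  · have h : epi (perspective φ s) = ⋂ g : {g : X × Y → EReal | LowerSemicontinuous g ∧
        IsConvexFun g ∧ g ≤ preperspective φ s}, epi g.1 := by
      ext p
      simp only [epi, perspective, sSup_apply, iSup_le_iff, Set.mem_ofPred_eq, Set.mem_iInter]
    unfold IsConvexFun
    rw [h]
    exact convex_iInter fun g => g.2.2.1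
  · exact sSup_le fun g hg => hg.2.2

end Perspective

end Perspective

open Perspective

/-!
The perspective `P` lies below the preperspective, so only two kinds of bounds are needed.

*Upper bounds.* If `φ x₀ ≤ b` and `recFun φ x ≤ r`, then `φ (x₀ + t • x) ≤ b + t * r` for `t ≥ 0`
(`le_add_mul_of_recFun_le`). Hence `P (x + c • x₀, z) ≤ c * b + r` whenever
`s z = c > 0`, and letting `c → 0`, `z → y`, lower semicontinuity gives `P (x, y) ≤ recFun φ x`
(`perspective_le_of_tendsto`). When `-s` is convex, `s y = 0` and `φ 0 ≤ 0`, take `x₀ = 0` and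
`b ≤ 0`: then `P (x, z) ≤ r` along the segment from a point of `S` to `y`, hence at `y`.
When `s` is convex and `s y ≤ 0`, a segment from `y` to a point of `S`
contains a last point at which `s ≤ 0`, and the bound holds there. As `{z | P (x, z) ≤ r}` is
closed and convex, a separating functional then shows that the bound holds at every
`y ∈ closedConvexHull ℝ S` with `s y ≤ 0`
(`perspective_le_of_mem_closedConvexHull`).

*Lower bounds.* By the Hahn-Banach theorem `φ` is the supremum of its continuous affine minorants
`f + a` (`MemGammaZero.exists_affineMinorant_gt`), so `c * φ (c⁻¹ • x)` is the supremum of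
`f x + a * c` and `recFun φ x` is bounded by the supremum of the `f x`. It remains to find lower
semicontinuous convex functions below the preperspective and at least `f x + a * s y` on `S`.
If `-s ∈ Γ₀` and `φ 0 ≤ 0`, then `a ≤ 0` and `f x + (-a) * (-s y)` will do. If `s ∈ Γ₀` and
`recFun φ ≤ φ`, then `f` itself minorizes `φ`, so that `a` may be replaced by `max a 0` and
`f x + (max a 0) * max (s y) 0` will do; `recFun φ ≠ φ` provides a minorant with `a > 0`, which
forces `P = ⊤` where `s = ⊤`. Finally, `P = ⊤` off `X × C` for any closed
convex set `C ⊇ S` (`perspective_eq_top`).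

If `φ = recFun φ`, then `φ` is positively homogeneous (`smul_le_of_eq_recFun`), so the
preperspective at `(x, y)` equals `φ x` for every `y ∈ S`. The bound `φ x ≤ P (x, y)` is immediate, and
`{z | P (x, z) ≤ r}` is a closed convex set containing `S` whenever `φ x ≤ r`.
-/

open Filter Topology

namespace Perspective

/-! ### Extended real arithmetic -/

theorem coe_mul_le_coe_iff {c r : ℝ} (hc : 0 < c) {v : EReal} :
    (c : EReal) * v ≤ r ↔ v ≤ ((r / c : ℝ) : EReal) := by
  induction v with
  | bot => simp [EReal.coe_mul_bot_of_pos hc]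
  | top => simp [EReal.coe_mul_top_of_pos hc]
  | coe v =>
    rw [← EReal.coe_mul, EReal.coe_le_coe_iff, EReal.coe_le_coe_iff, le_div_iff₀' hc]

theorem coe_le_coe_mul_iff {c r : ℝ} (hc : 0 < c) {v : EReal} :
    (r : EReal) ≤ c * v ↔ ((r / c : ℝ) : EReal) ≤ v := by
  induction v with
  | bot => simp [EReal.coe_mul_bot_of_pos hc]
  | top => simp [EReal.coe_mul_top_of_pos hc]
  | coe v =>
    rw [← EReal.coe_mul, EReal.coe_le_coe_iff, EReal.coe_le_coe_iff, div_le_iff₀' hc]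

theorem coe_add_le_coe_iff {a r : ℝ} {v : EReal} :
    (a : EReal) + v ≤ r ↔ v ≤ ((r - a : ℝ) : EReal) := by
  induction v with
  | bot => simp
  | top => simp [-EReal.coe_sub]
  | coe v =>
    rw [← EReal.coe_add, EReal.coe_le_coe_iff, EReal.coe_le_coe_iff, le_sub_iff_add_le']

theorem exists_coe_of_pos_of_lt_top {v : EReal} (h0 : 0 < v) (h1 : v < ⊤) :
    ∃ c : ℝ, 0 < c ∧ v = c := by
  lift v to ℝ using ⟨h1.ne, (EReal.bot_lt_zero.trans h0).ne'⟩
  exact ⟨v, EReal.coe_pos.1 h0, rfl⟩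

/-! ### Convexity and recession functions -/

theorem IsProper.exists_real {E : Type*} {φ : E → EReal} (hφ : IsProper φ) :
    ∃ x, ∃ b : ℝ, φ x = b := by
  obtain ⟨x, hx⟩ := hφ.2
  exact ⟨x, (φ x).toReal, (EReal.coe_toReal hx (hφ.1 x)).symm⟩

theorem recFun_le_iff {E : Type*} [AddCommGroup E] {φ : E → EReal}
    (hφ : IsProper φ) {x : E} {r : ℝ} :
    recFun φ x ≤ r ↔ ∀ y : E, ∀ b : ℝ, φ y = b → φ (x + y) ≤ ((b + r : ℝ) : EReal) := by
  simp only [recFun, iSup_le_iff]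
  refine ⟨fun h y b hb => ?_, fun h y hy => ?_⟩
  · have h1 := h y (by simp [effDom, hb])
    rw [hb, EReal.sub_le_iff_le_add (by simp) (by simp)] at h1
    rwa [add_comm b, EReal.coe_add]
  · have hb : φ y = (φ y).toReal := (EReal.coe_toReal hy.ne (hφ.1 y)).symm
    rw [hb, EReal.sub_le_iff_le_add (by simp) (by simp), ← EReal.coe_add, add_comm r]
    exact h y _ hb

theorem recFun_ne_bot {E : Type*} [AddCommGroup E] {φ : E → EReal} (hφ : IsProper φ) (x : E) :
    recFun φ x ≠ ⊥ := by
  obtain ⟨y, b, hb⟩ := hφ.exists_real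
  intro h
  -- A recession value of `⊥` would be bounded by every real number.
  have hr : ∀ r : ℝ, φ (x + y) ≤ r := fun r => by
    simpa using (recFun_le_iff hφ (r := r - b)).1 (h ▸ bot_le) y b hb
  exact hφ.1 _ (le_bot_iff.1 (EReal.le_of_forall_lt_iff_le.1 fun z _ => hr z))

theorem recFun_zero {E : Type*} [AddCommGroup E] {φ : E → EReal} (hφ : IsProper φ) :
    recFun φ 0 ≤ 0 := by
  have := (recFun_le_iff hφ (x := 0) (r := 0)).2 fun y b hb => by simp [hb]
  simpa using this

section Convexity

variable {E : Type*} [AddCommGroup E] [Module ℝ E]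

theorem IsConvexFun.le_combo {g : E → EReal} (hg : IsConvexFun g) {u v : E} {α β : ℝ}
    (hu : g u ≤ α) (hv : g v ≤ β) {t : ℝ} (h0 : 0 ≤ t) (h1 : t ≤ 1) :
    g ((1 - t) • u + t • v) ≤ (((1 - t) * α + t * β : ℝ) : EReal) :=
  hg (x := (u, α)) hu (y := (v, β)) hv (sub_nonneg.2 h1) h0 (by ring)

theorem IsConvexFun.convex_le {g : E → EReal} (hg : IsConvexFun g) (r : ℝ) :
    Convex ℝ {x | g x ≤ (r : EReal)} := by
  intro u hu v hv a b ha hb hab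
  obtain rfl : a = 1 - b := by linarith
  have := hg.le_combo hu hv hb (by linarith)
  rwa [← add_mul, sub_add_cancel, one_mul] at this

/-- Along the direction `x`, the function grows with slope at most `recFun φ x`. The definition
gives this for steps of integer length, and convexity interpolates. -/
theorem le_add_mul_of_recFun_le {φ : E → EReal} (hφ : IsProper φ) (hc : IsConvexFun φ)
    {x x₀ : E} {b r : ℝ} (hb : φ x₀ = b) (hr : recFun φ x ≤ r) {t : ℝ} (ht : 0 ≤ t) :
    φ (x₀ + t • x) ≤ ((b + t * r : ℝ) : EReal) := by
  have step : ∀ n : ℕ, φ (x₀ + (n : ℝ) • x) ≤ ((b + n * r : ℝ) : EReal) := by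
    intro n
    induction n with
    | zero => simp [hb]
    | succ n ih =>
      have hne : φ (x₀ + (n : ℝ) • x) ≠ ⊤ := (ih.trans_lt (EReal.coe_lt_top _)).ne
      have he := (EReal.coe_toReal hne (hφ.1 _)).symm
      have h1 := (recFun_le_iff hφ).1 hr _ _ he
      rw [he, EReal.coe_le_coe_iff] at ih
      have h2 : x + (x₀ + (n : ℝ) • x) = x₀ + ((n + 1 : ℕ) : ℝ) • x := by
        push_cast; module
      rw [h2] at h1
      refine h1.trans (EReal.coe_le_coe_iff.2 ?_)
      push_cast
      linarith
  obtain ⟨n, hn⟩ := exists_nat_gt t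
  have hn0 : (0 : ℝ) < n := ht.trans_lt hn
  have h := hc.le_combo hb.le (step n) (t := t / n) (by positivity) ((div_le_one hn0).2 hn.le)
  have e1 : (1 - t / n) • x₀ + (t / n) • (x₀ + (n : ℝ) • x) = x₀ + t • x := by
    rw [smul_add, smul_smul, div_mul_cancel₀ _ hn0.ne']; module
  have e2 : (1 - t / n) * b + t / n * (b + n * r) = b + t * r := by
    field_simp; ring
  rwa [e1, e2] at h

/-- A convex function equal to its recession function is positively homogeneous; the converse
inequality follows by exchanging the roles of `t` and `t⁻¹`. -/
theorem smul_le_of_eq_recFun {φ : E → EReal} (hφ : IsProper φ) (hc : IsConvexFun φ)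
    (h : φ = recFun φ) {t : ℝ} (ht : 0 < t) (u : E) : φ (t • u) ≤ t * φ u := by
  have h0 : φ 0 = (0 : ℝ) := by
    have hle : φ 0 ≤ 0 := h ▸ recFun_zero hφ
    have hv : φ 0 = (φ 0).toReal :=
      (EReal.coe_toReal (hle.trans_lt EReal.zero_lt_top).ne (hφ.1 0)).symm
    -- `φ 0 = φ (0 + 0) ≤ φ 0 + recFun φ 0 = φ 0 + φ 0`.
    have h1 := (recFun_le_iff hφ).1 (h ▸ hv.le : recFun φ 0 ≤ (φ 0).toReal) 0 _ hv
    rw [zero_add, hv, EReal.coe_le_coe_iff] at h1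
    rw [hv] at hle ⊢
    rw [EReal.coe_eq_coe_iff]
    rw [EReal.toReal_coe] at h1
    have : (φ 0).toReal ≤ 0 := by exact_mod_cast hle
    linarith
  refine EReal.le_of_forall_lt_iff_le.1 fun r hr => ?_
  have h1 : recFun φ u ≤ ((r / t : ℝ) : EReal) := h ▸ (coe_mul_le_coe_iff ht).1 hr.le
  have h2 := le_add_mul_of_recFun_le hφ hc h0 h1 ht.le
  rwa [zero_add, zero_add, mul_div_cancel₀ _ ht.ne'] at h2

end Convexity

/-! ### Continuous affine minorants -/

theorem isClosed_epi {E : Type*} [TopologicalSpace E] {φ : E → EReal}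
    (hφ : LowerSemicontinuous φ) : IsClosed (epi φ) :=
  hφ.isClosed_epigraph.preimage
    (continuous_fst.prodMk (continuous_coe_real_ereal.comp continuous_snd))

section Minorants

variable {X : Type*} [AddCommGroup X] [Module ℝ X] [TopologicalSpace X]

/-- The continuous affine function `u ↦ f u + a` minorizes `φ`. -/
def IsAffineMinorant (φ : X → EReal) (f : StrongDual ℝ X) (a : ℝ) : Prop :=
  ∀ u, ((f u + a : ℝ) : EReal) ≤ φ u

theorem IsAffineMinorant.le_of_le {φ : X → EReal} {f : StrongDual ℝ X} {a : ℝ}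
    (h : IsAffineMinorant φ f a) {u : X} {t : ℝ} (ht : φ u ≤ t) : f u + a ≤ t :=
  EReal.coe_le_coe_iff.1 ((h u).trans ht)

theorem isAffineMinorant_of_le {φ : X → EReal} {f : StrongDual ℝ X} {a : ℝ}
    (h : ∀ u, ∀ t : ℝ, φ u ≤ t → f u + a ≤ t) : IsAffineMinorant φ f a := fun u =>
  EReal.le_of_forall_lt_iff_le.1 fun t ht => EReal.coe_le_coe_iff.2 (h u t ht.le)

/-- The linear part of an affine minorant is bounded by the recession function. -/
theorem IsAffineMinorant.le_recFun {φ : X → EReal} (hφ : IsProper φ) (hc : IsConvexFun φ)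
    {f : StrongDual ℝ X} {a : ℝ} (h : IsAffineMinorant φ f a) (u : X) :
    ((f u : ℝ) : EReal) ≤ recFun φ u := by
  refine EReal.le_of_forall_lt_iff_le.1 fun r hr => EReal.coe_le_coe_iff.2 ?_
  obtain ⟨y, b, hb⟩ := hφ.exists_real
  by_contra! hlt
  -- Far enough along the direction `u`, the minorant would exceed `b + t * r`.
  obtain ⟨n, hn⟩ := exists_nat_gt ((b - f y - a) / (f u - r))
  rw [div_lt_iff₀ (sub_pos.2 hlt)] at hn
  have h1 := h.le_of_le (le_add_mul_of_recFun_le hφ hc hb hr.le (Nat.cast_nonneg n))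
  simp only [map_add, map_smul, smul_eq_mul] at h1
  linarith

/-- If affine minorants determine `φ`, their linear parts determine `recFun φ`: a minorant nearly
exact at `x + y` has linear part nearly `φ (x + y) - φ y` at `x`. -/
theorem recFun_le_of_forall_affineMinorant {φ : X → EReal} (hφ : IsProper φ)
    (hsup : ∀ u, ∀ r : ℝ, r < φ u → ∃ f a, IsAffineMinorant φ f a ∧ r < f u + a)
    {x : X} {v : EReal} (h : ∀ f a, IsAffineMinorant φ f a → ((f x : ℝ) : EReal) ≤ v) :
    recFun φ x ≤ v := by
  refine EReal.le_of_forall_lt_iff_le.1 fun r hr => (recFun_le_iff hφ).2 fun y b hb => ?_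
  refine EReal.ge_of_forall_gt_iff_ge.1 fun q hq => EReal.coe_le_coe_iff.2 ?_
  obtain ⟨f, a, hf, hlt⟩ := hsup _ q hq
  have h1 := hf.le_of_le hb.le
  have h2 : f x ≤ r := EReal.coe_le_coe_iff.1 ((h f a hf).trans hr.le)
  rw [map_add] at hlt
  linarith

theorem mul_le_of_forall_affineMinorant {φ : X → EReal}
    (hsup : ∀ u, ∀ r : ℝ, r < φ u → ∃ f a, IsAffineMinorant φ f a ∧ r < f u + a)
    {x : X} {c : ℝ} (hc : 0 < c) {v : EReal}
    (h : ∀ f a, IsAffineMinorant φ f a → ((f x + a * c : ℝ) : EReal) ≤ v) :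
    (c : EReal) * φ (c⁻¹ • x) ≤ v := by
  refine EReal.le_of_forall_lt_iff_le.1 fun r hr => (coe_mul_le_coe_iff hc).2 ?_
  refine EReal.ge_of_forall_gt_iff_ge.1 fun q hq => EReal.coe_le_coe_iff.2 ?_
  obtain ⟨f, a, hf, hlt⟩ := hsup _ q hq
  have h1 : f x + a * c ≤ r := EReal.coe_le_coe_iff.1 ((h f a hf).trans hr.le)
  rw [map_smul, smul_eq_mul, inv_mul_eq_div, ← sub_lt_iff_lt_add, lt_div_iff₀ hc] at hlt
  rw [le_div_iff₀ hc]
  linarith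

theorem isAffineMinorant_of_separating {φ : X → EReal} {f : StrongDual ℝ X} {β c : ℝ}
    (hβ : 0 < β) (h : ∀ x, ∀ t : ℝ, φ x ≤ t → c < f x + β * t) :
    IsAffineMinorant φ (-(β⁻¹ • f)) (β⁻¹ * c) := by
  refine isAffineMinorant_of_le fun u t ht => ?_
  have h1 := h u t ht
  have h2 : β⁻¹ * c ≤ β⁻¹ * (f u + β * t) := by gcongr
  rw [mul_add, inv_mul_cancel_left₀ hβ.ne'] at h2
  simp only [neg_apply, smul_apply, smul_eq_mul]
  linarith

variable [IsTopologicalAddGroup X] [ContinuousSMul ℝ X] [LocallyConvexSpace ℝ X]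

/-- A point strictly below the graph is separated from the epigraph by a closed hyperplane, which
may be vertical (`β = 0`). -/
theorem MemGammaZero.exists_separating {φ : X → EReal} (hφ : MemGammaZero φ) {u : X} {r : ℝ}
    (hr : r < φ u) : ∃ (f : StrongDual ℝ X) (β c : ℝ), 0 ≤ β ∧ f u + β * r < c ∧
      ∀ x, ∀ t : ℝ, φ x ≤ t → c < f x + β * t := by
  obtain ⟨F, c, h1, h2⟩ := geometric_hahn_banach_point_closed hφ.convex (isClosed_epi hφ.lsc)
    (x := (u, r)) (fun h => not_le.2 hr h)
  have hF : ∀ x, ∀ t : ℝ, F (x, t) = F (x, 0) + F (0, 1) * t := fun x t => by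
    have : (x, t) = (x, (0 : ℝ)) + t • ((0 : X), (1 : ℝ)) := by simp
    rw [this, map_add, map_smul, smul_eq_mul, mul_comm]
  have h2' : ∀ x, ∀ t : ℝ, φ x ≤ t → c < F (x, 0) + F (0, 1) * t := fun x t h =>
    hF x t ▸ h2 (x, t) h
  refine ⟨F.comp (ContinuousLinearMap.inl ℝ X ℝ), F (0, 1), c, ?_, hF u r ▸ h1, h2'⟩
  obtain ⟨x, b, hb⟩ := hφ.proper.exists_real
  by_contra! hneg
  -- The epigraph is unbounded above, so `F` cannot decrease in the vertical direction.
  obtain ⟨n, hn⟩ := exists_nat_gt ((F (x, 0) + F (0, 1) * b - c) / (-F (0, 1)))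
  rw [div_lt_iff₀ (neg_pos.2 hneg)] at hn
  have := h2' x (b + n) (hb.le.trans (EReal.coe_le_coe_iff.2 (by simp)))
  linarith

theorem MemGammaZero.exists_affineMinorant {φ : X → EReal} (hφ : MemGammaZero φ) :
    ∃ f a, IsAffineMinorant φ f a := by
  obtain ⟨x, b, hb⟩ := hφ.proper.exists_real
  obtain ⟨f, β, c, hβ, h1, h2⟩ := hφ.exists_separating (u := x) (r := b - 1)
    (hb ▸ EReal.coe_lt_coe_iff.2 (by linarith))
  have h3 := h2 x b hb.le
  have hβ' : 0 < β := by linarith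
  exact ⟨_, _, isAffineMinorant_of_separating hβ' h2⟩

/-- A function in `Γ₀` is the supremum of its continuous affine minorants. -/
theorem MemGammaZero.exists_affineMinorant_gt {φ : X → EReal} (hφ : MemGammaZero φ) (u : X)
    (r : ℝ) (hr : r < φ u) : ∃ f a, IsAffineMinorant φ f a ∧ r < f u + a := by
  obtain ⟨f, β, c, hβ, h1, h2⟩ := hφ.exists_separating hr
  rcases hβ.eq_or_lt with rfl | hβ'
  · -- The hyperplane is vertical: add a large multiple of `c - f`, which is positive at `u` and
    -- negative on the domain, to some affine minorant.
    simp only [zero_mul, add_zero] at h1 h2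
    obtain ⟨g, a, hg⟩ := hφ.exists_affineMinorant
    obtain ⟨n, hn⟩ := exists_nat_gt ((r - g u - a) / (c - f u))
    rw [div_lt_iff₀ (sub_pos.2 h1)] at hn
    refine ⟨g - (n : ℝ) • f, a + n * c, isAffineMinorant_of_le fun x t ht => ?_, ?_⟩
    · have h3 := hg.le_of_le ht
      have h4 : (n : ℝ) * c ≤ n * f x := by gcongr; exact (h2 x t ht).le
      simp only [sub_apply, smul_apply, smul_eq_mul]
      linarith
    · simp only [sub_apply, smul_apply, smul_eq_mul]
      linarith
  · refine ⟨_, _, isAffineMinorant_of_separating hβ' h2, ?_⟩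
    have h3 : β⁻¹ * (f u + β * r) < β⁻¹ * c := by gcongr
    rw [mul_add, inv_mul_cancel_left₀ hβ'.ne'] at h3
    simp only [neg_apply, smul_apply, smul_eq_mul]
    linarith

end Minorants

/-! ### Lower bounds for the perspective -/

theorem preperspective_of_eq {X Y : Type*} [AddCommGroup X] [Module ℝ X] {φ : X → EReal}
    {s : Y → EReal} {y : Y} {c : ℝ} (hc : 0 < c) (hs : s y = c) (x : X) :
    preperspective φ s (x, y) = c * φ (c⁻¹ • x) := by
  simp [preperspective, hs, hc]

section Bounds

variable {X Y : Type*} [AddCommGroup X] [Module ℝ X] [TopologicalSpace X]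
  [AddCommGroup Y] [Module ℝ Y] [TopologicalSpace Y]

theorem perspective_le_mul {φ : X → EReal} {s : Y → EReal} {y : Y} {c : ℝ} (hc : 0 < c)
    (hs : s y = c) (x : X) : perspective φ s (x, y) ≤ c * φ (c⁻¹ • x) :=
  preperspective_of_eq (φ := φ) hc hs x ▸ (perspective_isGreatest φ s).1.2.2 (x, y)

theorem le_perspective {φ : X → EReal} {s : Y → EReal} {g : X × Y → EReal}
    (hl : LowerSemicontinuous g) (hc : IsConvexFun g)
    (h : ∀ x y, ∀ c : ℝ, 0 < c → s y = c → g (x, y) ≤ c * φ (c⁻¹ • x)) :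
    g ≤ perspective φ s := by
  refine (perspective_isGreatest φ s).2 ⟨hl, hc, fun ⟨x, y⟩ => ?_⟩
  by_cases hy : 0 < s y ∧ s y < ⊤
  · obtain ⟨c, hc, hs⟩ := exists_coe_of_pos_of_lt_top hy.1 hy.2
    exact preperspective_of_eq (φ := φ) hc hs x ▸ h x y c hc hs
  · simp [preperspective, hy]

theorem perspective_eq_top {φ : X → EReal} {s : Y → EReal} {C : Set Y} (hcl : IsClosed C)
    (hconv : Convex ℝ C) (hC : ∀ y, 0 < s y → s y < ⊤ → y ∈ C) {y : Y} (hy : y ∉ C) (x : X) :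
    perspective φ s (x, y) = ⊤ := by
  have hle : (fun p : X × Y => if p.2 ∈ C then (⊥ : EReal) else ⊤) ≤ perspective φ s := by
    refine le_perspective ?_ ?_ ?_
    · rw [lowerSemicontinuous_iff_isClosed_preimage]
      intro v
      by_cases hv : v = ⊤
      · simp [hv]
      · convert hcl.preimage (continuous_snd (X := X)) using 1
        ext p
        by_cases hp : p.2 ∈ C <;> simp [hp, hv]
    · have e : epi (fun p : X × Y => if p.2 ∈ C then (⊥ : EReal) else ⊤) =
          (LinearMap.snd ℝ X Y).comp (LinearMap.fst ℝ (X × Y) ℝ) ⁻¹' C := by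
        ext p
        by_cases hp : p.1.2 ∈ C <;> simp [epi, hp]
      exact (congrArg (Convex ℝ) e).mpr (hconv.linear_preimage _)
    · intro x y c hc hs
      simp [hC y (hs ▸ EReal.coe_pos.2 hc) (hs ▸ EReal.coe_lt_top c)]
  simpa [hy] using hle (x, y)

/-- The basic lower bound: an affine minorant `f + a` of `φ` and a lower semicontinuous convex
function `b * h` lying below `a * s` on `S` produce a lower semicontinuous convex minorant of the
preperspective. -/
theorem add_mul_le_perspective {φ : X → EReal} {s h : Y → EReal} {f : StrongDual ℝ X} {a b : ℝ}
    (hf : IsAffineMinorant φ f a) (hb : 0 ≤ b) (hl : LowerSemicontinuous h) (hc : IsConvexFun h)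
    (hle : ∀ y, ∀ c : ℝ, 0 < c → s y = c → (b : EReal) * h y ≤ ((a * c : ℝ) : EReal))
    (x : X) (y : Y) : (f x : EReal) + b * h y ≤ perspective φ s (x, y) := by
  refine le_perspective (g := fun p => (f p.1 : EReal) + b * h p.2) ?_ ?_ ?_ (x, y)
  · refine LowerSemicontinuous.add' ?_ ?_ fun p => EReal.continuousAt_add (by simp) (by simp)
    · exact (continuous_coe_real_ereal.comp
        (f.continuous.comp continuous_fst)).lowerSemicontinuous
    · rcases hb.eq_or_lt with rfl | hb'
      · simpa using lowerSemicontinuous_const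
      · have hcont : Continuous fun v : EReal => (b : EReal) * v := by
          refine continuous_iff_continuousAt.2 fun v => ?_
          refine (EReal.continuousAt_mul (p := ((b : EReal), v)) ?_ ?_ ?_ ?_).comp
            (continuousAt_const.prodMk continuousAt_id) <;> left <;> simp [hb'.ne']
        exact (hcont.comp_lowerSemicontinuous hl fun u v huv =>
          mul_le_mul_of_nonneg_left huv (EReal.coe_nonneg.2 hb)).comp continuous_snd
  · intro p hp q hq α β hα hβ hαβ
    simp only [epi, Set.mem_ofPred_eq, coe_add_le_coe_iff] at hp hq ⊢
    rcases hb.eq_or_lt with rfl | hb'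
    · simp only [EReal.coe_zero, zero_mul, EReal.coe_nonneg, Prod.fst_add, Prod.smul_fst,
        Prod.snd_add, Prod.smul_snd, map_add, map_smul, smul_eq_mul] at hp hq ⊢
      have := mul_nonneg hα hp
      have := mul_nonneg hβ hq
      linarith
    · rw [coe_mul_le_coe_iff hb'] at hp hq ⊢
      obtain rfl : α = 1 - β := by linarith
      refine (hc.le_combo hp hq hβ (by linarith)).trans_eq (EReal.coe_eq_coe_iff.2 ?_)
      simp only [Prod.fst_add, Prod.smul_fst, Prod.snd_add, Prod.smul_snd, map_add, map_smul,
        smul_eq_mul]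
      ring
  · intro x y c hc hs
    have h1 : ((f x + a * c : ℝ) : EReal) ≤ c * φ (c⁻¹ • x) := by
      rw [coe_le_coe_mul_iff hc]
      convert hf (c⁻¹ • x) using 2
      rw [map_smul, smul_eq_mul]
      field_simp
    refine le_trans ?_ h1
    rw [EReal.coe_add]
    gcongr
    exact hle y c hc hs

/-! ### Upper bounds for the perspective -/

theorem isClosed_perspective_le (φ : X → EReal) (s : Y → EReal) (x : X) (r : ℝ) :
    IsClosed {y | perspective φ s (x, y) ≤ r} :=
  ((perspective_isGreatest φ s).1.1.isClosed_preimage (r : EReal)).preimage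
    (continuous_const.prodMk continuous_id)

theorem convex_perspective_le (φ : X → EReal) (s : Y → EReal) (x : X) (r : ℝ) :
    Convex ℝ {y | perspective φ s (x, y) ≤ r} := by
  intro u hu v hv a b ha hb hab
  have h := (perspective_isGreatest φ s).1.2.1.convex_le r (x := (x, u)) hu (y := (x, v)) hv
    ha hb hab
  have e : a • (x, u) + b • (x, v) = (x, a • u + b • v) := by
    simp [← add_smul, hab]
  rwa [e] at h

theorem perspective_add_smul_le {φ : X → EReal} (hφ : IsProper φ) (hconv : IsConvexFun φ)
    {s : Y → EReal} {x x₀ : X} {b r : ℝ} (hb : φ x₀ = b) (hr : recFun φ x ≤ r) {z : Y} {c : ℝ}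
    (hc : 0 < c) (hs : s z = c) :
    perspective φ s (x + c • x₀, z) ≤ ((c * b + r : ℝ) : EReal) := by
  refine (perspective_le_mul hc hs _).trans ((coe_mul_le_coe_iff hc).2 ?_)
  have h := le_add_mul_of_recFun_le hφ hconv hb hr (inv_nonneg.2 hc.le)
  have e1 : c⁻¹ • (x + c • x₀) = x₀ + c⁻¹ • x := by
    rw [smul_add, inv_smul_smul₀ hc.ne', add_comm]
  have e2 : (c * b + r) / c = b + c⁻¹ * r := by field_simp
  rwa [e1, e2]

theorem perspective_le_of_tendsto [ContinuousAdd X] [ContinuousSMul ℝ X] {φ : X → EReal}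
    (hφ : IsProper φ) (hconv : IsConvexFun φ) {s : Y → EReal} {x : X} {r : ℝ}
    (hr : recFun φ x ≤ r) {ι : Type*} {l : Filter ι} [l.NeBot] {z : ι → Y} {c : ι → ℝ} {y : Y}
    (hz : Tendsto z l (𝓝 y)) (hc : Tendsto c l (𝓝 0))
    (h : ∀ᶠ i in l, 0 < c i ∧ s (z i) = c i) : perspective φ s (x, y) ≤ r := by
  obtain ⟨x₀, b, hb⟩ := hφ.exists_real
  by_contra! hlt
  obtain ⟨q, hq1, hq2⟩ := EReal.lt_iff_exists_real_btwn.1 hlt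
  have hx : Tendsto (fun i => (x + c i • x₀, z i)) l (𝓝 (x, y)) := by
    refine Tendsto.prodMk_nhds ?_ hz
    simpa using tendsto_const_nhds.add (hc.smul_const x₀)
  have h1 := hx.eventually ((perspective_isGreatest φ s).1.1 (x, y) q hq2)
  have h2 : Tendsto (fun i => c i * b + r) l (𝓝 r) := by
    simpa using (hc.mul_const b).add_const r
  refine not_le.2 (EReal.coe_lt_coe_iff.1 hq1) (ge_of_tendsto h2 ?_)
  filter_upwards [h1, h] with i hi hi'
  exact EReal.coe_le_coe_iff.1
    (hi.le.trans (perspective_add_smul_le hφ hconv hb hr hi'.1 hi'.2))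

/-- On a segment from a point where `s ≤ 0` to a point of `S`, the bound holds at the last point
where `s ≤ 0`: beyond it `s` is positive, and convexity bounds `s` by a quantity tending to `0`. -/
theorem exists_mem_segment_perspective_le [ContinuousAdd X] [ContinuousSMul ℝ X]
    [ContinuousAdd Y] [ContinuousSMul ℝ Y] {φ : X → EReal}
    (hφ : IsProper φ) (hconv : IsConvexFun φ) {s : Y → EReal} (hs : LowerSemicontinuous s)
    (hsc : IsConvexFun s) {x : X} {r : ℝ} (hr : recFun φ x ≤ r) {y w : Y} (hy : s y ≤ 0)
    {d : ℝ} (hd : 0 < d) (hw : s w = d) :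
    ∃ t ∈ Set.Icc (0 : ℝ) 1, perspective φ s (x, (1 - t) • y + t • w) ≤ r := by
  set T : Set ℝ := Set.Icc 0 1 ∩ {t | s ((1 - t) • y + t • w) ≤ 0} with hT
  have hcont : Continuous fun t : ℝ => (1 - t) • y + t • w := by fun_prop
  have hTc : IsCompact T :=
    isCompact_Icc.inter_right ((hs.isClosed_preimage 0).preimage hcont)
  obtain ⟨t, ⟨ht, hst⟩, hmax⟩ := hTc.exists_isGreatest ⟨0, by simp, by simpa using hy⟩
  have ht1 : t < 1 := by
    refine lt_of_le_of_ne ht.2 ?_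
    rintro rfl
    have : (d : EReal) ≤ 0 := by simpa [hw] using hst
    exact hd.not_ge (by exact_mod_cast this)
  refine ⟨t, ht, ?_⟩
  set z := (1 - t) • y + t • w with hzdef
  have hz : s z ≤ ((0 : ℝ) : EReal) := by simpa using hst
  have key : ∀ ε ∈ Set.Ioc (0 : ℝ) 1, ∃ c : ℝ, 0 < c ∧ c ≤ ε * d ∧
      s ((1 - ε) • z + ε • w) = c := by
    intro ε hε
    have hle := hsc.le_combo hz hw.le hε.1.le hε.2
    have hpos : 0 < s ((1 - ε) • z + ε • w) := by
      by_contra! hneg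
      have hmem : t + ε * (1 - t) ∈ T := by
        have h1 : 0 ≤ ε * (1 - t) := mul_nonneg hε.1.le (by linarith)
        have h2 : ε * (1 - t) ≤ 1 * (1 - t) := by
          exact mul_le_mul_of_nonneg_right hε.2 (by linarith)
        refine ⟨⟨by linarith [ht.1], by linarith⟩, ?_⟩
        have e : (1 - (t + ε * (1 - t))) • y + (t + ε * (1 - t)) • w
            = (1 - ε) • z + ε • w := by
          rw [hzdef]; module
        simpa only [Set.mem_ofPred_eq, e] using hneg
      have := hmax hmem
      have : 0 < ε * (1 - t) := mul_pos hε.1 (by linarith)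
      linarith
    obtain ⟨c, hc, hsc'⟩ := exists_coe_of_pos_of_lt_top hpos (hle.trans_lt (EReal.coe_lt_top _))
    refine ⟨c, hc, ?_, hsc'⟩
    rw [hsc', EReal.coe_le_coe_iff] at hle
    linarith
  have hev : ∀ᶠ ε in 𝓝[>] (0 : ℝ), ε ∈ Set.Ioc (0 : ℝ) 1 :=
    Ioc_mem_nhdsGT one_pos
  have hc : ∀ᶠ ε in 𝓝[>] (0 : ℝ), 0 < (s ((1 - ε) • z + ε • w)).toReal ∧
      (s ((1 - ε) • z + ε • w)).toReal ≤ ε * d ∧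
      s ((1 - ε) • z + ε • w) = (s ((1 - ε) • z + ε • w)).toReal := by
    filter_upwards [hev] with ε hε
    obtain ⟨c, h1, h2, h3⟩ := key ε hε
    rw [h3, EReal.toReal_coe]
    exact ⟨h1, h2, rfl⟩
  refine perspective_le_of_tendsto (l := 𝓝[>] (0 : ℝ))
    (z := fun ε => (1 - ε) • z + ε • w)
    (c := fun ε => (s ((1 - ε) • z + ε • w)).toReal) hφ hconv hr ?_ ?_
    (hc.mono fun ε h => ⟨h.1, h.2.2⟩)
  · have : Continuous fun ε : ℝ => (1 - ε) • z + ε • w := by fun_prop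
    simpa using (this.tendsto 0).mono_left nhdsWithin_le_nhds
  · have h0 : Tendsto (fun ε : ℝ => ε * d) (𝓝[>] (0 : ℝ)) (𝓝 0) := by
      simpa using ((continuous_mul_const d).tendsto 0).mono_left nhdsWithin_le_nhds
    exact tendsto_of_tendsto_of_tendsto_of_le_of_le' tendsto_const_nhds h0
      (hc.mono fun ε h => h.1.le) (hc.mono fun ε h => h.2.1)

theorem perspective_le_of_mem_closedConvexHull [ContinuousAdd X] [ContinuousSMul ℝ X]
    [IsTopologicalAddGroup Y] [ContinuousSMul ℝ Y] [LocallyConvexSpace ℝ Y] {φ : X → EReal}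
    (hφ : IsProper φ) (hconv : IsConvexFun φ) {s : Y → EReal} (hs : LowerSemicontinuous s)
    (hsc : IsConvexFun s) {x : X} {r : ℝ} (hr : recFun φ x ≤ r) {y : Y} (hy : s y ≤ 0)
    (hyS : y ∈ closedConvexHull ℝ (s ⁻¹' Set.Ioo 0 ⊤)) : perspective φ s (x, y) ≤ r := by
  by_contra hn
  obtain ⟨F, u, h1, h2⟩ := geometric_hahn_banach_point_closed (convex_perspective_le φ s x r)
    (isClosed_perspective_le φ s x r) (x := y) hn
  -- The half-space `u ≤ F` misses `y`, so it cannot contain `S`.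
  obtain ⟨w, hw, hwu⟩ : ∃ w ∈ s ⁻¹' Set.Ioo 0 ⊤, F w < u := by
    by_contra! hall
    have hsub := closedConvexHull_min (s := s ⁻¹' Set.Ioo 0 ⊤) (t := {w | u ≤ F w}) hall
      (convex_halfSpace_ge F.isLinear u) (isClosed_le continuous_const F.continuous)
    exact not_le.2 h1 (hsub hyS)
  obtain ⟨d, hd, hwd⟩ := exists_coe_of_pos_of_lt_top hw.1 hw.2
  obtain ⟨t, ht, hle⟩ := exists_mem_segment_perspective_le hφ hconv hs hsc hr hy hd hwd
  have h3 := h2 _ hle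
  have h4 : F ((1 - t) • y + t • w) ≤ u :=
    (convex_halfSpace_le F.isLinear u) h1.le hwu.le (sub_nonneg.2 ht.2) ht.1 (by ring)
  linarith

theorem memGammaZero_perspective {φ : X → EReal} (hφ : IsProper φ) {s : Y → EReal}
    (hne : (s ⁻¹' Set.Ioo 0 ⊤).Nonempty) (hbot : ∀ x y, perspective φ s (x, y) ≠ ⊥) :
    MemGammaZero (perspective φ s) := by
  refine ⟨⟨fun p => hbot p.1 p.2, ?_⟩, (perspective_isGreatest φ s).1.1,
    (perspective_isGreatest φ s).1.2.1⟩
  obtain ⟨y, hy⟩ := hne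
  obtain ⟨c, hc, hs⟩ := exists_coe_of_pos_of_lt_top hy.1 hy.2
  obtain ⟨x₀, b, hb⟩ := hφ.exists_real
  refine ⟨(c • x₀, y), ((perspective_le_mul hc hs _).trans_lt ?_).ne⟩
  rw [inv_smul_smul₀ hc.ne', hb, ← EReal.coe_mul]
  exact EReal.coe_lt_top _

theorem mul_ne_bot_of_pos {v w : EReal} (h0 : 0 < v) (h1 : v < ⊤) (hw : w ≠ ⊥) : v * w ≠ ⊥ := by
  obtain ⟨c, hc, rfl⟩ := exists_coe_of_pos_of_lt_top h0 h1
  induction w with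
  | bot => exact absurd rfl hw
  | top => simp [EReal.coe_mul_top_of_pos hc]
  | coe w => exact_mod_cast EReal.coe_ne_bot (c * w)

end Bounds

section Formulas

variable {X Y : Type*} [AddCommGroup X] [Module ℝ X] [TopologicalSpace X]
  [AddCommGroup Y] [Module ℝ Y] [TopologicalSpace Y]

/-! ### Convex scaling functions -/

/-- When `s` is convex and `recFun φ ≤ φ`, an affine minorant `f + a` may be used with the
coefficient `max a 0`, because `f` alone also minorizes `φ`. -/
theorem add_max_mul_le_perspective {φ : X → EReal} (hφ : MemGammaZero φ)
    (hrec : recFun φ ≤ φ) {s : Y → EReal} (hs : LowerSemicontinuous s) (hsc : IsConvexFun s)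
    {f : StrongDual ℝ X} {a : ℝ} (hf : IsAffineMinorant φ f a) (x : X) (y : Y) :
    (f x : EReal) + (max a 0 : ℝ) * max (s y) 0 ≤ perspective φ s (x, y) := by
  have hf' : IsAffineMinorant φ f (max a 0) := by
    rcases max_choice a 0 with h | h <;> rw [h]
    · exact hf
    · intro u
      simpa using (hf.le_recFun hφ.proper hφ.convex u).trans (hrec u)
  refine add_mul_le_perspective (h := fun y => max (s y) 0) hf' (le_max_right _ _)
    (hs.sup lowerSemicontinuous_const) ?_ ?_ x y
  · have h0 : Convex ℝ {p : Y × ℝ | 0 ≤ p.2} :=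
      convex_halfSpace_ge (LinearMap.snd ℝ Y ℝ).isLinear 0
    have e : epi (fun y => max (s y) 0) = epi s ∩ {p : Y × ℝ | 0 ≤ p.2} := by
      ext p
      simp [epi]
    exact (congrArg (Convex ℝ) e).mpr (hsc.inter h0)
  · intro y c hc h
    rw [h, max_eq_left (EReal.coe_nonneg.2 hc.le), EReal.coe_mul]

theorem perspective_eq_of_convex [IsTopologicalAddGroup X] [ContinuousSMul ℝ X]
    [LocallyConvexSpace ℝ X] [IsTopologicalAddGroup Y] [ContinuousSMul ℝ Y]
    [LocallyConvexSpace ℝ Y] {φ : X → EReal} (hφ : MemGammaZero φ)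
    (hrec : recFun φ ≤ φ) (hne : recFun φ ≠ φ) {s : Y → EReal} (hs : MemGammaZero s)
    (x : X) (y : Y) : perspective φ s (x, y) =
      if 0 < s y ∧ s y < ⊤ then s y * φ ((s y).toReal⁻¹ • x)
      else if y ∈ closedConvexHull ℝ (s ⁻¹' Set.Ioo 0 ⊤) ∧ s y ≤ 0 then recFun φ x
      else ⊤ := by
  have hlow := fun f a (hf : IsAffineMinorant φ f a) =>
    add_max_mul_le_perspective hφ hrec hs.lsc hs.convex hf x y
  split_ifs with h1 h2
  · obtain ⟨c, hc, hsy⟩ := exists_coe_of_pos_of_lt_top h1.1 h1.2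
    rw [hsy, EReal.toReal_coe]
    refine le_antisymm (perspective_le_mul hc hsy x)
      (mul_le_of_forall_affineMinorant hφ.exists_affineMinorant_gt hc fun f a hf => ?_)
    refine le_trans ?_ (hlow f a hf)
    rw [hsy, max_eq_left (EReal.coe_nonneg.2 hc.le), ← EReal.coe_mul, ← EReal.coe_add,
      EReal.coe_le_coe_iff]
    gcongr
    exact le_max_left _ _
  · refine le_antisymm ?_
      (recFun_le_of_forall_affineMinorant hφ.proper hφ.exists_affineMinorant_gt
        fun f a hf => ?_)
    · exact EReal.le_of_forall_lt_iff_le.1 fun r hr =>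
        perspective_le_of_mem_closedConvexHull hφ.proper hφ.convex hs.lsc hs.convex hr.le h2.2 h2.1
    · simpa [max_eq_right h2.2] using hlow f a hf
  · by_cases hy : y ∈ closedConvexHull ℝ (s ⁻¹' Set.Ioo 0 ⊤)
    · have hpos : 0 < s y := not_le.1 fun h => h2 ⟨hy, h⟩
      have htop : s y = ⊤ := not_lt_top_iff.1 fun h => h1 ⟨hpos, h⟩
      obtain ⟨u, hu⟩ : ∃ u, recFun φ u < φ u := by
        by_contra! h
        exact hne (le_antisymm hrec h)
      obtain ⟨r, hr1, hr2⟩ := EReal.lt_iff_exists_real_btwn.1 hu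
      -- A minorant exceeding `recFun φ u ≥ f u` at `u` has a positive constant term.
      obtain ⟨f, a, hf, hlt⟩ := hφ.exists_affineMinorant_gt u r hr2
      have hfu : f u < r := EReal.coe_lt_coe_iff.1
        ((hf.le_recFun hφ.proper hφ.convex u).trans_lt hr1)
      have ha : 0 < a := by linarith
      have := hlow f a hf
      rwa [htop, max_eq_left ha.le, max_eq_left le_top, EReal.coe_mul_top_of_pos ha,
        EReal.coe_add_top, top_le_iff] at this
    · exact perspective_eq_top isClosed_closedConvexHull convex_closedConvexHull
        (fun y h0 h1 => subset_closedConvexHull (𝕜 := ℝ) (s := s ⁻¹' Set.Ioo 0 ⊤) ⟨h0, h1⟩) hy x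

/-! ### Positively homogeneous functions -/

theorem perspective_eq_of_eq_recFun {φ : X → EReal} (hφ : MemGammaZero φ) (h : φ = recFun φ)
    (s : Y → EReal) (x : X) (y : Y) : perspective φ s (x, y) =
      φ x + indicatorFun (closedConvexHull ℝ (s ⁻¹' Set.Ioo 0 ⊤)) y := by
  by_cases hy : y ∈ closedConvexHull ℝ (s ⁻¹' Set.Ioo 0 ⊤)
  · rw [indicatorFun, if_pos hy, add_zero]
    refine le_antisymm (EReal.le_of_forall_lt_iff_le.1 fun r hr => ?_) ?_
    · refine closedConvexHull_min ?_ (convex_perspective_le φ s x r)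
        (isClosed_perspective_le φ s x r) hy
      intro z hz
      obtain ⟨c, hc, hs⟩ := exists_coe_of_pos_of_lt_top hz.1 hz.2
      refine (perspective_le_mul hc hs x).trans ((coe_mul_le_coe_iff hc).2 ?_)
      refine (smul_le_of_eq_recFun hφ.proper hφ.convex h (inv_pos.2 hc) x).trans
        ((coe_mul_le_coe_iff (inv_pos.2 hc)).2 (hr.le.trans (EReal.coe_le_coe_iff.2 ?_)))
      rw [div_inv_eq_mul, div_mul_cancel₀ _ hc.ne']
    · refine le_perspective (g := fun p : X × Y => φ p.1) (hφ.lsc.comp continuous_fst) ?_ ?_ (x, y)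
      · exact hφ.convex.linear_preimage
          (((LinearMap.fst ℝ X Y).comp (LinearMap.fst ℝ (X × Y) ℝ)).prod
            (LinearMap.snd ℝ (X × Y) ℝ))
      · intro x y c hc _
        simpa [smul_inv_smul₀ hc.ne'] using
          smul_le_of_eq_recFun hφ.proper hφ.convex h hc (c⁻¹ • x)
  · rw [indicatorFun, if_neg hy, EReal.add_top_of_ne_bot (hφ.proper.1 x)]
    exact perspective_eq_top isClosed_closedConvexHull convex_closedConvexHull
      (fun y h0 h1 => subset_closedConvexHull (𝕜 := ℝ) (s := s ⁻¹' Set.Ioo 0 ⊤) ⟨h0, h1⟩) hy x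

/-! ### Concave scaling functions -/

theorem perspective_le_of_concave [ContinuousAdd Y] [ContinuousSMul ℝ Y] {φ : X → EReal}
    (hφ : MemGammaZero φ) (h0 : φ 0 ≤ 0) {s : Y → EReal} (hs : IsConvexFun fun y => -s y)
    (htop : ∀ y, s y ≠ ⊤) (hne : (s ⁻¹' Set.Ioo 0 ⊤).Nonempty) {x : X} {r : ℝ}
    (hr : recFun φ x ≤ r) {y : Y} (hy : s y = 0) : perspective φ s (x, y) ≤ r := by
  obtain ⟨b, hb⟩ : ∃ b : ℝ, φ 0 = b :=
    ⟨_, (EReal.coe_toReal (h0.trans_lt EReal.zero_lt_top).ne (hφ.proper.1 0)).symm⟩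
  have hb0 : b ≤ 0 := by
    rw [hb] at h0
    exact_mod_cast h0
  obtain ⟨w, hw⟩ := hne
  obtain ⟨d, hd, hwd⟩ := exists_coe_of_pos_of_lt_top hw.1 hw.2
  have hcont : Continuous fun t : ℝ => (1 - t) • y + t • w := by fun_prop
  have key : ∀ t ∈ Set.Ioc (0 : ℝ) 1, perspective φ s (x, (1 - t) • y + t • w) ≤ r := by
    intro t ht
    have hle := hs.le_combo (u := y) (v := w) (α := 0) (β := -d) (by simp [hy])
      (by simp [hwd]) ht.1.le ht.2
    have hpos : 0 < s ((1 - t) • y + t • w) := by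
      have h1 : (1 - t) * 0 + t * -d < 0 := by nlinarith [mul_pos ht.1 hd]
      have h2 := hle.trans_lt (EReal.coe_lt_coe_iff.2 h1)
      simpa using h2
    obtain ⟨c, hc, hsc⟩ := exists_coe_of_pos_of_lt_top hpos (lt_top_iff_ne_top.2 (htop _))
    have h3 := perspective_add_smul_le hφ.proper hφ.convex hb hr hc hsc
    rw [smul_zero, add_zero] at h3
    refine h3.trans (EReal.coe_le_coe_iff.2 ?_)
    nlinarith [mul_nonneg hc.le (neg_nonneg.2 hb0)]
  have hclosed := (isClosed_perspective_le φ s x r).preimage hcont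
  have hmem := hclosed.mem_of_tendsto (f := id) (b := 𝓝[>] (0 : ℝ))
    nhdsWithin_le_nhds (mem_of_superset (Ioc_mem_nhdsGT one_pos) key)
  simpa using hmem

theorem perspective_eq_of_concave [IsTopologicalAddGroup X] [ContinuousSMul ℝ X]
    [LocallyConvexSpace ℝ X] [ContinuousAdd Y] [ContinuousSMul ℝ Y] {φ : X → EReal}
    (hφ : MemGammaZero φ) (h0 : φ 0 ≤ 0) {s : Y → EReal} (hs : MemGammaZero fun y => -s y)
    (hne : (s ⁻¹' Set.Ioo 0 ⊤).Nonempty) (x : X) (y : Y) : perspective φ s (x, y) =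
      if 0 < s y ∧ s y < ⊤ then s y * φ ((s y).toReal⁻¹ • x)
      else if s y = 0 then recFun φ x
      else ⊤ := by
  have htop : ∀ y, s y ≠ ⊤ := fun y h => hs.proper.1 y (by simp [h])
  have hlow : ∀ f a, IsAffineMinorant φ f a →
      (f x : EReal) + (-a : ℝ) * -s y ≤ perspective φ s (x, y) := fun f a hf => by
    have ha : a ≤ 0 := by
      have := hf.le_of_le (t := 0) (by simpa using h0)
      rwa [map_zero, zero_add] at this
    refine add_mul_le_perspective (h := fun y => -s y) hf (neg_nonneg.2 ha) hs.lsc hs.convex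
      (fun y c hc hsy => ?_) x y
    rw [hsy, ← EReal.coe_neg, ← EReal.coe_mul, neg_mul_neg]
  split_ifs with h1 h2
  · obtain ⟨c, hc, hsy⟩ := exists_coe_of_pos_of_lt_top h1.1 h1.2
    rw [hsy, EReal.toReal_coe]
    refine le_antisymm (perspective_le_mul hc hsy x)
      (mul_le_of_forall_affineMinorant hφ.exists_affineMinorant_gt hc fun f a hf => ?_)
    have := hlow f a hf
    rwa [hsy, ← EReal.coe_neg, ← EReal.coe_mul, neg_mul_neg, ← EReal.coe_add] at this
  · refine le_antisymm ?_
      (recFun_le_of_forall_affineMinorant hφ.proper hφ.exists_affineMinorant_gt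
        fun f a hf => ?_)
    · exact EReal.le_of_forall_lt_iff_le.1 fun r hr =>
        perspective_le_of_concave hφ h0 hs.convex htop hne hr.le h2
    · simpa [h2] using hlow f a hf
  · refine perspective_eq_top (C := {y | -s y ≤ ((0 : ℝ) : EReal)})
      (hs.lsc.isClosed_preimage _) (hs.convex.convex_le 0) (fun y h _ => ?_) ?_ x
    · simpa using h.le
    · intro hy
      have hy' : 0 ≤ s y := by simpa using hy
      exact h1 ⟨lt_of_le_of_ne hy' (Ne.symm h2), lt_top_iff_ne_top.2 (htop y)⟩

end Formulas

end Perspective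

theorem corollary5p3
    {X : Type*} [AddCommGroup X] [Module ℝ X] [TopologicalSpace X] [IsTopologicalAddGroup X]
    [ContinuousSMul ℝ X] [LocallyConvexSpace ℝ X] [T2Space X]
    {Y : Type*} [AddCommGroup Y] [Module ℝ Y] [TopologicalSpace Y] [IsTopologicalAddGroup Y]
    [ContinuousSMul ℝ Y] [LocallyConvexSpace ℝ Y] [T2Space Y]
    (φ : X → EReal) (hφ : MemGammaZero φ)
    (s : Y → EReal) (S : Set Y) (hS : S = s ⁻¹' Set.Ioo 0 ⊤) (hne : S.Nonempty) :
    -- case (i)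
    (recFun φ ≤ φ → recFun φ ≠ φ → MemGammaZero s →
      (∀ (x : X) (y : Y), perspective φ s (x, y) =
        if 0 < s y ∧ s y < ⊤ then s y * φ ((s y).toReal⁻¹ • x)
        else if y ∈ closedConvexHull ℝ S ∧ s y ≤ 0 then recFun φ x
        else ⊤) ∧
      MemGammaZero (perspective φ s)) ∧
    -- case (ii)
    (φ = recFun φ →
      (∀ (x : X) (y : Y), perspective φ s (x, y) =
        φ x + indicatorFun (closedConvexHull ℝ S) y) ∧
      MemGammaZero (perspective φ s)) ∧
    -- case (iii)
    (φ ≠ recFun φ → φ 0 ≤ 0 → MemGammaZero (fun y => -s y) →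
      (∀ (x : X) (y : Y), perspective φ s (x, y) =
        if 0 < s y ∧ s y < ⊤ then s y * φ ((s y).toReal⁻¹ • x)
        else if s y = 0 then recFun φ x
        else ⊤) ∧
      MemGammaZero (perspective φ s)) := by
  subst hS
  refine ⟨fun hrec hrne hs => ?_, fun h => ?_, fun _ h0 hs => ?_⟩
  · have hP := perspective_eq_of_convex hφ hrec hrne hs
    refine ⟨hP, memGammaZero_perspective hφ.proper hne fun x y => ?_⟩
    rw [hP]
    split_ifs with h1 h2
    · exact mul_ne_bot_of_pos h1.1 h1.2 (hφ.proper.1 _)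
    · exact recFun_ne_bot hφ.proper x
    · exact top_ne_bot
  · have hP := perspective_eq_of_eq_recFun hφ h s
    refine ⟨hP, memGammaZero_perspective hφ.proper hne fun x y => ?_⟩
    rw [hP, indicatorFun]
    split_ifs
    · simpa using hφ.proper.1 x
    · simp [EReal.add_top_of_ne_bot (hφ.proper.1 x)]
  · have hP := perspective_eq_of_concave hφ h0 hs hne
    refine ⟨hP, memGammaZero_perspective hφ.proper hne fun x y => ?_⟩
    rw [hP]
    split_ifs with h1 h2
    · exact mul_ne_bot_of_pos h1.1 h1.2 (hφ.proper.1 _)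
    · exact recFun_ne_bot hφ.proper x
    · exact top_ne_bot
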